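/- A represented space is a set $X$ with a surjective partial map $\delta_X :\subseteq \{0,1\}^{\mathbb N}\to X$; points with $\delta_X(p)=x$ are names of $x$. A map between represented spaces is computable (continuous) if some computable (continuous) partial map on $\{0,1\}^{\mathbb N}$ sends names of arguments to names of values. $\mathcal C(\mathbf X,\mathbf Y)$ is the represented space of continuous functions, a name of $f$ being a code of a continuous realizer of $f$. With Sierpiński space $\mathbb S$, $\mathcal O(\mathbf X)\cong\mathcal C(\mathbf X,\mathbb S)$ is the space of open sets, $\mathcal A(\mathbf X)$ the space of closed sets (a name of $A$ is a name of $X\setminus A$ in $\mathcal O(\mathbf X)$), and $\mathcal K(\mathbf X)$ the space of compact sets (a name of $K$ is a name of $\{U \mid K\subseteq U\}$ in $\mathcal O(\mathcal O(\mathbf X))$). For $A\subseteq\{0,1\}^{\mathbb N}$, $\mathbf X_A$ is the set $\delta_X[A]$ represented by the restriction of $\delta_X$ to $A$; for $S \subseteq X$, $\mathbf X_{|S}$ is the set $S$ represented by the restriction of $\delta_X$ to $\delta_X^{-1}[S]$. A computable metric space is a metric space with a dense sequence $(a_i)_{i\in\mathbb N}$ whose mutual distances are computable uniformly in the indices, and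 with a representation computably equivalent to the Cauchy representation. The representation $\delta_X$ is called proper if $K\mapsto\delta_X^{-1}[K]$ is a well-defined and computable map $\mathcal K(\mathbf X)\to\mathcal K(\{0,1\}^{\mathbb N})$. Lemma. Let $\mathbf X$, $\mathbf Y$ be computable metric spaces, and let $\delta_X$ be proper. 1. The map $A\mapsto\delta_X[A] : \mathcal A(\{0,1\}^{\mathbb N})\to\mathcal A(\mathbf X)$ is well-defined (that is, $\delta_X[A]$ is closed whenever $A$ is) and computable. 2. There is a computable partial function on $\{0,1\}^{\mathbb N}$ that, for every $A\in\mathcal A(\{0,1\}^{\mathbb N})$ and every $f\in\mathcal C(\mathbf X_A,\mathbf Y)$, maps each pair consisting of a name of $A$ and a name of $f$ to a name of $f$ as an element of $\mathcal C(\mathbf X_{|\delta_X[A]},\mathbf Y)$. -/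

import Mathlib

namespace TypeTwo

/-- Cantor space `{0,1}^ℕ` (with the product topology, `Bool` being discrete). -/
abbrev Cantor : Type := ℕ → Bool

/-- The word `p 0, …, p (n-1)`. -/
def pre (p : Cantor) (n : ℕ) : List Bool := (List.range n).map p

/-- The pair `⟨p, q⟩` of two sequences, obtained by interleaving. -/
def interleave (p q : Cantor) : Cantor :=
  fun n => if n % 2 = 0 then p (n / 2) else q (n / 2)

/-- The word function `h` transforms the input sequence `p` into the output sequence `q`: on longer
and longer prefixes of `p`, it produces prefixes of `q` of unbounded length.
For computable `h`, this is what a Type-2 machine does. Such a machine can read `p` bit by bit and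
append to its one-way output tape whatever `h` of the prefix read so far adds to it. Conversely,
for a given machine let `h w` be what it has written after `|w|` steps on an input starting
with `w`. -/
def Transforms (h : List Bool → List Bool) (p q : Cantor) : Prop :=
  (∀ n, ∃ m, h (pre p n) = pre q m) ∧ ∀ m, ∃ n, m ≤ (h (pre p n)).length

/-- The sequence `p` codes the word function `h`, through its graph. -/
def Codes (p : Cantor) (h : List Bool → List Bool) : Prop :=
  ∀ u v : List Bool, p (Encodable.encode (u, v)) = true ↔ h u = v

theorem pre_length (p : Cantor) (n : ℕ) : (pre p n).length = n := by simp [pre]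

theorem pre_getElem? (p : Cantor) {n i : ℕ} (h : i < n) : (pre p n)[i]? = some (p i) := by
  simp [pre, h]

theorem Transforms.unique {h : List Bool → List Bool} {p q q' : Cantor}
    (H : Transforms h p q) (H' : Transforms h p q') : q = q' := by
  funext i
  obtain ⟨n, hn⟩ := H.2 (i + 1)
  obtain ⟨m, hm⟩ := H.1 n
  obtain ⟨m', hm'⟩ := H'.1 n
  have e : i < m := by rw [hm, pre_length] at hn; omega
  have e' : i < m' := by rw [hm', pre_length] at hn; omega
  have h1 := pre_getElem? q e
  rw [← hm, hm', pre_getElem? q' e'] at h1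
  exact (Option.some.inj h1).symm

theorem Codes.unique {p : Cantor} {h h' : List Bool → List Bool}
    (H : Codes p h) (H' : Codes p h') : h = h' := by
  funext u
  exact ((H' u (h u)).1 ((H u (h u)).2 rfl)).symm

theorem Codes.exists (h : List Bool → List Bool) : ∃ p, Codes p h := by
  classical
  refine ⟨fun n => decide (∃ u, n = Encodable.encode (u, h u)), fun u v => ?_⟩
  simp only [decide_eq_true_eq, Encodable.encode_inj, Prod.mk.injEq]
  constructor
  · rintro ⟨w, rfl, rfl⟩
    rfl
  · rintro rfl
    exact ⟨u, rfl, rfl⟩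

/-- A representation of `X`: a surjective partial function from Cantor space to `X`, given by its
graph; `Names p x` says that `p` is a name of `x`. A set with a representation is a
represented space. -/
structure Representation (X : Type*) where
  Names : Cantor → X → Prop
  unique : ∀ {p x y}, Names p x → Names p y → x = y
  surj : ∀ x, ∃ p, Names p x

/-- Cantor space, represented by the identity. -/
def cantor : Representation Cantor where
  Names p x := p = x
  unique h h' := h.symm.trans h'
  surj x := ⟨x, rfl⟩

/-- Sierpiński space: truth is recognised after finitely many steps, falsity never. -/
def sierpinski : Representation Prop where
  Names p P := P ↔ ∃ n, p n = true
  unique h h' := propext (h.trans h'.symm)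
  surj P := by
    classical
    exact ⟨fun _ => decide P, by simp⟩

namespace Representation

variable {X Y : Type*}

/-- The image `δ[A]` of a set of names. -/
def image (δ : Representation X) (A : Set Cantor) : Set X := {x | ∃ p ∈ A, δ.Names p x}

/-- The preimage `δ⁻¹[S]`: all names of points of `S`. -/
def preimage (δ : Representation X) (S : Set X) : Set Cantor := {p | ∃ x ∈ S, δ.Names p x}

/-- The word function `h` realizes `f`: it transforms names of `x` into names of `f x`. -/
def Realizes (δX : Representation X) (δY : Representation Y)
    (h : List Bool → List Bool) (f : X → Y) : Prop :=
  ∀ p x, δX.Names p x → ∃ q, Transforms h p q ∧ δY.Names q (f x)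

/-- `f` is computable as a map between represented spaces. -/
def IsComputable (δX : Representation X) (δY : Representation Y) (f : X → Y) : Prop :=
  ∃ h, Computable h ∧ δX.Realizes δY h f

/-- Computable equivalence of two representations of the same set. -/
def Equivalent (δ δ' : Representation X) : Prop :=
  IsComputable δ δ' id ∧ IsComputable δ' δ id

/-- `p` is a name of the function `f`: it codes a realizer of `f`. -/
def FunName (δX : Representation X) (δY : Representation Y) (p : Cantor) (f : X → Y) : Prop :=
  ∃ h, Codes p h ∧ δX.Realizes δY h f

theorem FunName.unique {δX : Representation X} {δY : Representation Y} {p : Cantor}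
    {f g : X → Y} (hf : δX.FunName δY p f) (hg : δX.FunName δY p g) : f = g := by
  obtain ⟨h, hp, H⟩ := hf
  obtain ⟨h', hp', H'⟩ := hg
  obtain rfl := hp.unique hp'
  funext x
  obtain ⟨q, hq⟩ := δX.surj x
  obtain ⟨r, hr, hy⟩ := H q x hq
  obtain ⟨r', hr', hy'⟩ := H' q x hq
  obtain rfl := hr.unique hr'
  exact δY.unique hy hy'

/-- The continuous functions between two represented spaces: those with a continuous realizer. -/
def ContFun (δX : Representation X) (δY : Representation Y) : Type _ :=
  {f : X → Y // ∃ p, δX.FunName δY p f}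

/-- The represented space `𝒞(X, Y)`. -/
def functions (δX : Representation X) (δY : Representation Y) :
    Representation (ContFun δX δY) where
  Names p f := δX.FunName δY p f.1
  unique h h' := Subtype.ext (h.unique h')
  surj f := f.2

/-- The open subsets of a represented space: those with a continuous characteristic function into
Sierpiński space. -/
def OpenSet (δ : Representation X) : Type _ :=
  {U : Set X // ∃ p, δ.FunName sierpinski p (fun x => x ∈ U)}

/-- The represented space `𝒪(X)`. -/
def opens (δ : Representation X) : Representation (OpenSet δ) where
  Names p U := δ.FunName sierpinski p (fun x => x ∈ U.1)
  unique h h' := Subtype.ext (Set.ext fun x => iff_of_eq (congrFun (h.unique h') x))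
  surj U := U.2

/-- The closed subsets of a represented space: the complements of the open ones. -/
def ClosedSet (δ : Representation X) : Type _ :=
  {A : Set X // ∃ p, δ.FunName sierpinski p (fun x => x ∉ A)}

/-- The represented space `𝒜(X)`: a name of a closed set is a name of its open complement. -/
def closeds (δ : Representation X) : Representation (ClosedSet δ) where
  Names p A := δ.FunName sierpinski p (fun x => x ∉ A.1)
  unique h h' := Subtype.ext (Set.ext fun x =>
    not_iff_not.1 (iff_of_eq (congrFun (h.unique h') x)))
  surj A := A.2

/-- The compact subsets of a represented space: those `K`, saturated, for which `{U | K ⊆ U}` is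
an open subset of `𝒪(X)`. (In a `T₁` space every set is saturated.) -/
def CompactSet (δ : Representation X) : Type _ :=
  {K : Set X // (∀ x, (∀ U : OpenSet δ, K ⊆ U.1 → x ∈ U.1) → x ∈ K) ∧
    ∃ p, δ.opens.FunName sierpinski p (fun U => K ⊆ U.1)}

/-- The represented space `𝒦(X)`: a name of `K` is a name of `{U | K ⊆ U}` in `𝒪(𝒪(X))`. -/
def compacts (δ : Representation X) : Representation (CompactSet δ) where
  Names p K := δ.opens.FunName sierpinski p (fun U => K.1 ⊆ U.1)
  unique {p K L} h h' := by
    have e : ∀ U : OpenSet δ, K.1 ⊆ U.1 ↔ L.1 ⊆ U.1 := fun U =>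
      iff_of_eq (congrFun (h.unique h') U)
    refine Subtype.ext (Set.Subset.antisymm (fun x hx => ?_) (fun x hx => ?_))
    · exact L.2.1 x fun U hU => (e U).2 hU hx
    · exact K.2.1 x fun U hU => (e U).1 hU hx
  surj K := K.2.2

/-- `δ` is proper (in the effective sense): taking preimages of compact sets is a well-defined and
computable map `δ⁻¹ : 𝒦(X) → 𝒦({0,1}^ℕ)`. -/
def IsProper (δ : Representation X) : Prop :=
  ∃ F : CompactSet δ → CompactSet cantor,
    (∀ K, (F K).1 = δ.preimage K.1) ∧ IsComputable δ.compacts cantor.compacts F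

/-- The represented space `X_A`: the set `δ[A]`, represented by the restriction of `δ` to `A`. -/
def restrict (δ : Representation X) (A : Set Cantor) : Representation (δ.image A) where
  Names p x := p ∈ A ∧ δ.Names p x.1
  unique h h' := Subtype.ext (δ.unique h.2 h'.2)
  surj x := x.2

/-- The subspace of a represented space on `S ⊆ X`: every `δ`-name of a point of `S` is kept. -/
def subspace (δ : Representation X) (S : Set X) : Representation S where
  Names p x := δ.Names p x.1
  unique h h' := Subtype.ext (δ.unique h h')
  surj x := δ.surj x.1

end Representation

/-- The data that make a metric space a computable metric space: a dense sequence whose mutual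
distances are computable real numbers, uniformly in the indices. -/
structure ComputableMetric (X : Type*) [MetricSpace X] where
  pt : ℕ → X
  dense : DenseRange pt
  dist_computable : ∃ c : ℕ × ℕ × ℕ → ℕ, Computable c ∧
    ∀ i j n, |dist (pt i) (pt j) - (c (i, j, n) : ℝ) / 2 ^ n| ≤ 1 / 2 ^ n

/-- The Cauchy representation: a name of `x` codes (through its graph) a sequence of indices
`s : ℕ → ℕ` such that `pt (s n)` has distance at most `2⁻ⁿ` from `x`. -/
def ComputableMetric.cauchy {X : Type*} [MetricSpace X] (M : ComputableMetric X) :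
    Representation X where
  Names p x := ∃ s : ℕ → ℕ, (∀ n i, p (Nat.pair n i) = true ↔ s n = i) ∧
    ∀ n, dist (M.pt (s n)) x ≤ 1 / 2 ^ n
  unique {p x y} := by
    rintro ⟨s, hs, hx⟩ ⟨t, ht, hy⟩
    have hst : s = t := funext fun n => ((ht n (s n)).1 ((hs n (s n)).2 rfl)).symm
    subst hst
    have lim : Filter.Tendsto (fun n : ℕ => (1 : ℝ) / 2 ^ n) Filter.atTop (nhds 0) := by
      simpa [one_div, inv_pow] using
        tendsto_pow_atTop_nhds_zero_of_lt_one (r := (2 : ℝ)⁻¹) (by norm_num) (by norm_num)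
    exact tendsto_nhds_unique
      (tendsto_iff_dist_tendsto_zero.2 (squeeze_zero (fun _ => dist_nonneg) hx lim))
      (tendsto_iff_dist_tendsto_zero.2 (squeeze_zero (fun _ => dist_nonneg) hy lim))
  surj x := by
    classical
    have hex : ∀ n : ℕ, ∃ i, dist (M.pt i) x ≤ 1 / 2 ^ n := fun n => by
      obtain ⟨i, hi⟩ := M.dense.exists_dist_lt x (show (0 : ℝ) < 1 / 2 ^ n by positivity)
      exact ⟨i, by rw [dist_comm]; exact hi.le⟩
    choose s hs using hex
    exact ⟨fun k => decide (s k.unpair.1 = k.unpair.2), s, by simp, hs⟩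

end TypeTwo

/-!
# Images of closed sets under a proper representation, and extension of functions to all names

Since a metric space is `T₁`, a name of a point `x` yields a name of the compact set `{x}`, and
properness of `δ` turns it into a name of the compact set `δ⁻¹[{x}]` of all names of `x`. Hence, for
an open set `W` of sequences, it is semidecidable, uniformly in `x` and `W`, whether all names of
`x` belong to `W` (`approximates_fiberTest`). Both parts of the theorem apply this test.

* `x` lies outside `δ[A]` iff all names of `x` belong to the complement of `A`
  (`funName_compl_image`). That `δ[A]` is closed in the metric follows, as a set with an open name
  is open in the metric (`ComputableMetric.isOpen_of_funName`).
* Let `f` be given by a realizer that works on names in `A` only, and let `W n i` be the set of all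
  `z` that are seen to lie outside `A`, or for which the realizer is seen to produce a point at
  distance less than `2⁻ⁿ` from the `i`-th point of the dense sequence. This is an open set, whatever
  the realizer does outside `A`. For `x` in `δ[A]`, which has a name in `A`, all names of `x` belong
  to `W n i` iff `f x` has distance less than `2⁻ⁿ` from the `i`-th point (`forall_seenBall_iff`).
  Searching such an `i` for every `n` gives a Cauchy name of `f x` (`approximates_cauchyValue`),
  whichever name of `x` is given.

Computations on sequences are expressed by word functions evaluated on prefixes. A machine with two
inputs is a function `g` of two words, and all that is said about it is which sequence the words
`g (pre p n) (pre q n)` approximate as `n` grows (`Approximates`). Passing to a name of the function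
`q ↦ g p q` needs no search: the word function `u ↦ g (pre p |u|) u` is total and its code is
computable from `p` (`curry`). Conversely, `run` evaluates names of functions.
-/

open Filter

namespace TypeTwo

/-! ### Prefixes -/

theorem pre_congr {p q : Cantor} {n : ℕ} (h : ∀ i < n, p i = q i) : pre p n = pre q n :=
  List.map_congr_left fun i hi => h i (List.mem_range.1 hi)

theorem pre_take (p : Cantor) (n k : ℕ) : (pre p n).take k = pre p (min k n) := by
  simp [pre, ← List.map_take, List.take_range]

theorem pre_getD (p : Cantor) {n i : ℕ} (h : i < n) : (pre p n).getD i false = p i := by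
  simp [List.getD_eq_getElem?_getD, pre_getElem? p h]

theorem eq_of_pre_eq {p q : Cantor} {n i : ℕ} (h : pre p n = pre q n) (hi : i < n) : p i = q i := by
  rw [← pre_getD p hi, h, pre_getD q hi]

theorem pre_pos {p : Cantor} {n : ℕ} : true ∈ pre p n ↔ ∃ i < n, p i = true := by
  simp [pre]

/-- The words `a n` are longer and longer prefixes of `p`. -/
def Approximates (a : ℕ → List Bool) (p : Cantor) : Prop :=
  (∀ n, a n = pre p (a n).length) ∧ Tendsto (fun n => (a n).length) atTop atTop

theorem approximates_pre (p : Cantor) : Approximates (pre p) p :=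
  ⟨fun n => by rw [pre_length], by simp only [pre_length]; exact tendsto_id⟩

theorem Approximates.of_pre {p : Cantor} {l : ℕ → ℕ} (h : Tendsto l atTop atTop) :
    Approximates (fun n => pre p (l n)) p :=
  ⟨fun n => by rw [pre_length], by simpa [pre_length] using h⟩

theorem Approximates.transforms {h : List Bool → List Bool} {p q : Cantor}
    (H : Approximates (fun n => h (pre p n)) q) : Transforms h p q :=
  ⟨fun n => ⟨_, H.1 n⟩, fun m => (H.2.eventually_ge_atTop m).exists⟩

theorem Transforms.eq_pre {h : List Bool → List Bool} {p q : Cantor} (H : Transforms h p q)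
    (n : ℕ) : h (pre p n) = pre q (h (pre p n)).length := by
  obtain ⟨m, hm⟩ := H.1 n
  rw [hm, pre_length]

/-- A word function that depends on a parameter word as well as on its input transforms `q` into
`r` as soon as its values on prefixes of equal length approximate `r`. -/
theorem Approximates.transforms_diag {g : List Bool → List Bool → List Bool} {p q r : Cantor}
    (H : Approximates (fun n => g (pre p n) (pre q n)) r) :
    Transforms (fun u => g (pre p u.length) u) q r :=
  Approximates.transforms (by simpa only [pre_length] using H)

/-! ### Composition of word functions -/

/-- A longest word in a list of words. -/
def longest (l : List (List Bool)) : List Bool :=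
  l.foldl (fun v w => if v.length ≤ w.length then w else v) []

theorem longest_concat (l : List (List Bool)) (w : List Bool) :
    longest (l ++ [w]) = if (longest l).length ≤ w.length then w else longest l := by
  rw [longest, List.foldl_append]
  rfl

theorem longest_mem (l : List (List Bool)) : longest l = [] ∨ longest l ∈ l := by
  induction l using List.reverseRecOn with
  | nil => exact Or.inl rfl
  | append_singleton l w ih =>
    rw [longest_concat]
    split_ifs
    · simp
    · exact ih.imp_right (by simp +contextual)

theorem length_le_longest {l : List (List Bool)} {v : List Bool} (hv : v ∈ l) :
    v.length ≤ (longest l).length := by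
  induction l using List.reverseRecOn with
  | nil => simp at hv
  | append_singleton l w ih =>
    rw [longest_concat]
    rcases List.mem_append.1 hv with h | h
    · split_ifs with hw
      · exact (ih h).trans hw
      · exact ih h
    · obtain rfl := List.mem_singleton.1 h
      split_ifs with hw <;> omega

/-- If all words in the lists `l n` are prefixes of `q`, and arbitrarily long ones occur, each
from some point on, then the longest ones approximate `q`. -/
theorem approximates_longest {l : ℕ → List (List Bool)} {q : Cantor}
    (h1 : ∀ n, ∀ v ∈ l n, v = pre q v.length)
    (h2 : ∀ m, ∀ᶠ n in atTop, ∃ v ∈ l n, m ≤ v.length) :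
    Approximates (fun n => longest (l n)) q := by
  refine ⟨fun n => ?_, tendsto_atTop.2 fun m => (h2 m).mono fun n hn => ?_⟩
  · rcases longest_mem (l n) with h | h
    · simp [h, pre]
    · exact h1 n _ h
  · obtain ⟨v, hv, hm⟩ := hn
    exact hm.trans (length_le_longest hv)

/-- The longest output of `h` on a prefix of `w`. Unlike `h` itself, this produces long outputs on
all long prefixes of the input, hence can be composed with other word functions. -/
def mono (h : List Bool → List Bool) (w : List Bool) : List Bool :=
  longest ((List.range (w.length + 1)).map fun k => h (w.take k))

/-- Continuity of the transformation `p ↦ q` along arbitrary approximations of `p`. -/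
theorem Transforms.approximates {h : List Bool → List Bool} {p q : Cantor} {a : ℕ → List Bool}
    (H : Transforms h p q) (ha : Approximates a p) :
    Approximates (fun n => mono h (a n)) q := by
  refine approximates_longest (fun n v hv => ?_) fun m => ?_
  · obtain ⟨k, -, rfl⟩ := List.mem_map.1 hv
    rw [ha.1 n, pre_take]
    exact H.eq_pre _
  · obtain ⟨k, hk⟩ := H.2 m
    filter_upwards [ha.2.eventually_ge_atTop k] with n hn
    refine ⟨_, List.mem_map.2 ⟨k, by simpa [Nat.lt_succ_iff] using hn, rfl⟩, ?_⟩
    rw [ha.1 n, pre_take, min_eq_left hn]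
    exact hk

/-! ### Universal machine and codes with parameters -/

/-- The pair of words with number `j`, if there is one. -/
def decodePair (j : ℕ) : Option (List Bool × List Bool) :=
  Encodable.decode₂ (List Bool × List Bool) j

theorem decodePair_eq_some {j : ℕ} {u v : List Bool} :
    decodePair j = some (u, v) ↔ Encodable.encode (u, v) = j :=
  Encodable.decode₂_eq_some

theorem decodePair_encode (u v : List Bool) :
    decodePair (Encodable.encode (u, v)) = some (u, v) :=
  decodePair_eq_some.2 rfl

/-- What the `j`-th bit of a code, if it is present in the word `w`, says about the output on
inputs with prefix `u`. -/
def entry (w u : List Bool) (j : ℕ) : List Bool :=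
  (decodePair j).elim [] fun x =>
    if w.getD j false = true ∧ u.take x.1.length = x.1 then x.2 else []

/-- The universal machine: `run w u` is the longest output found when `w` is a prefix of a code
of a word function and `u` a prefix of the input. -/
def run (w u : List Bool) : List Bool :=
  longest ((List.range w.length).map (entry w u))

/-- Correctness of the universal machine. -/
theorem Codes.approximates {h : List Bool → List Bool} {p q r : Cantor} {a b : ℕ → List Bool}
    (hp : Codes p h) (H : Transforms h q r) (ha : Approximates a p) (hb : Approximates b q) :
    Approximates (fun n => run (a n) (b n)) r := by
  refine approximates_longest (fun n v hv => ?_) fun m => ?_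
  · obtain ⟨j, hj, rfl⟩ := List.mem_map.1 hv
    rw [List.mem_range] at hj
    unfold entry
    rcases e : decodePair j with _ | ⟨v, v'⟩
    · simp [pre]
    · rw [decodePair_eq_some] at e
      subst e
      rw [Option.elim_some]
      split_ifs with hx
      · rw [ha.1 n, pre_getD p hj, hp, hb.1 n, pre_take] at hx
        obtain ⟨rfl, hx⟩ := hx
        dsimp only at hx ⊢
        rw [← hx]
        exact H.eq_pre _
      · simp [pre]
  · obtain ⟨k, hk⟩ := H.2 m
    filter_upwards [ha.2.eventually_gt_atTop (Encodable.encode (pre q k, h (pre q k))),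
      hb.2.eventually_ge_atTop k] with n hn hn'
    refine ⟨_, List.mem_map.2 ⟨_, List.mem_range.2 hn, rfl⟩, ?_⟩
    have h1 := pre_getD p hn
    rw [← ha.1 n, (hp _ _).2 rfl] at h1
    have h2 : (b n).take (pre q k).length = pre q k := by
      rw [hb.1 n, pre_take, pre_length, min_eq_left hn']
    rw [entry, decodePair_encode, Option.elim_some, if_pos ⟨h1, h2⟩]
    exact hk

/-- The code of the word function `h`: the characteristic sequence of its graph. -/
def code (h : List Bool → List Bool) : Cantor := fun j =>
  (decodePair j).elim false fun x => decide (h x.1 = x.2)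

theorem codes_code (h : List Bool → List Bool) : Codes (code h) h := fun u v => by
  rw [code, decodePair_encode, Option.elim_some, decide_eq_true_eq]

/-- The prefix, of the same length as `w`, of the code of the word function obtained from `g` when
`w` is a prefix of the parameter. On an input `u` this word function uses only the prefix of length
`|u|` of the parameter: therefore it is total, and its code is found without any search. -/
def curry (g : List Bool → List Bool → List Bool) (w : List Bool) : List Bool :=
  pre (code fun u => g (w.take u.length) u) w.length

theorem Approximates.curry {a : ℕ → List Bool} {p : Cantor} (ha : Approximates a p)
    (g : List Bool → List Bool → List Bool) :
    Approximates (fun n => curry g (a n)) (code fun u => g (pre p u.length) u) := by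
  have e : ∀ n, TypeTwo.curry g (a n) =
      pre (code fun u => g (pre p u.length) u) (a n).length := fun n => by
    refine pre_congr fun i hi => ?_
    unfold code
    rcases e : decodePair i with _ | ⟨u, v⟩
    · rfl
    · rw [decodePair_eq_some] at e
      have hu : u.length ≤ (a n).length := by
        have h1 := Encodable.length_le_encode u
        have h2 := Nat.left_le_pair (Encodable.encode u) (Encodable.encode v)
        rw [← Encodable.encode_prod_val, e] at h2
        omega
      have h3 : (a n).take u.length = pre p u.length := by
        rw [ha.1 n, pre_take, min_eq_left hu]
      simp only [Option.elim_some, h3]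
  simp only [e]
  exact Approximates.of_pre ha.2

/-! ### Pairs, and prefixes of names in Sierpiński space -/

/-- The bits of a word at even places. -/
def evens (w : List Bool) : List Bool :=
  pre (fun k => w.getD (2 * k) false) ((w.length + 1) / 2)

/-- The bits of a word at odd places. -/
def odds (w : List Bool) : List Bool :=
  pre (fun k => w.getD (2 * k + 1) false) (w.length / 2)

theorem evens_pre (p q : Cantor) (n : ℕ) :
    evens (pre (interleave p q) n) = pre p ((n + 1) / 2) := by
  rw [evens, pre_length]
  refine pre_congr fun i hi => ?_
  rw [pre_getD _ (by omega)]
  simp [interleave]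

theorem odds_pre (p q : Cantor) (n : ℕ) :
    odds (pre (interleave p q) n) = pre q (n / 2) := by
  rw [odds, pre_length]
  refine pre_congr fun i hi => ?_
  rw [pre_getD _ (by omega)]
  have h1 : (2 * i + 1) % 2 = 1 := by omega
  have h2 : (2 * i + 1) / 2 = i := by omega
  simp [interleave, h1, h2]

theorem approximates_evens (p q : Cantor) :
    Approximates (fun n => evens (pre (interleave p q) n)) p := by
  simp only [evens_pre]
  exact Approximates.of_pre (tendsto_atTop.2 fun m => by
    filter_upwards [eventually_ge_atTop (2 * m)] with n hn
    omega)

theorem approximates_odds (p q : Cantor) :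
    Approximates (fun n => odds (pre (interleave p q) n)) q := by
  simp only [odds_pre]
  exact Approximates.of_pre (tendsto_atTop.2 fun m => by
    filter_upwards [eventually_ge_atTop (2 * m)] with n hn
    omega)

/-- Whether a word contains the bit `true`, so that as a prefix of a name of a point of Sierpiński
space it witnesses truth. -/
def hit (w : List Bool) : Bool := decide (true ∈ w)

theorem Approximates.exists_of_hit {a : ℕ → List Bool} {q : Cantor} (ha : Approximates a q)
    {n : ℕ} (h : hit (a n) = true) : ∃ i, q i = true := by
  rw [hit, decide_eq_true_eq, ha.1 n, pre_pos] at h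
  exact h.imp fun _ => And.right

theorem Approximates.eventually_hit {a : ℕ → List Bool} {q : Cantor} (ha : Approximates a q)
    (h : ∃ i, q i = true) : ∀ᶠ n in atTop, hit (a n) = true := by
  obtain ⟨i, hi⟩ := h
  filter_upwards [ha.2.eventually_gt_atTop i] with n hn
  rw [hit, decide_eq_true_eq, ha.1 n, pre_pos]
  exact ⟨i, hn, hi⟩

/-! ### Computability of the word functions -/

section Computability

variable {α : Type*} [Primcodable α]

theorem computable_map_range {β : Type*} [Primcodable β] {f : α → ℕ → β} {n : α → ℕ}
    (hf : Computable₂ f) (hn : Computable n) :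
    Computable fun a => (List.range (n a)).map (f a) := by
  have h : Computable fun a => Nat.rec (motive := fun _ => List β) []
      (fun k l => l ++ [f a k]) (n a) :=
    Computable.nat_rec hn (Computable.const [])
      (Computable.list_concat.comp (Computable.snd.comp Computable.snd)
        (hf.comp Computable.fst (Computable.fst.comp Computable.snd))).to₂
  refine h.of_eq fun a => ?_
  induction n a with
  | zero => rfl
  | succ k ih => simp only [List.range_succ, List.map_append, List.map_singleton, ih]

theorem computable_pre {f : α → Cantor} {n : α → ℕ} (hf : Computable₂ f) (hn : Computable n) :
    Computable fun a => pre (f a) (n a) :=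
  computable_map_range hf hn

theorem primrec_longest : Primrec longest :=
  Primrec.list_foldl Primrec.id (Primrec.const [])
    (Primrec.ite (Primrec.nat_le.comp
        (Primrec.list_length.comp (Primrec.fst.comp Primrec.snd))
        (Primrec.list_length.comp (Primrec.snd.comp Primrec.snd)))
      (Primrec.snd.comp Primrec.snd) (Primrec.fst.comp Primrec.snd)).to₂

theorem computable_take {w : α → List Bool} {k : α → ℕ} (hw : Computable w) (hk : Computable k) :
    Computable fun a => (w a).take (k a) :=
  Primrec.list_take.to_comp.comp hk hw

theorem computable_getD {w : α → List Bool} {k : α → ℕ} (hw : Computable w) (hk : Computable k) :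
    Computable fun a => (w a).getD (k a) false :=
  (Primrec.list_getD false).to_comp.comp hw hk

theorem computable_length {w : α → List Bool} (hw : Computable w) :
    Computable fun a => (w a).length :=
  Computable.list_length.comp hw

theorem computable_mono {h : List Bool → List Bool} (hh : Computable h) :
    Computable (mono h) :=
  primrec_longest.to_comp.comp (computable_map_range
    (hh.comp (computable_take Computable.fst Computable.snd))
    (Computable.succ.comp Computable.list_length))

theorem primrec_decodePair : Primrec decodePair :=
  Primrec.decode₂

theorem primrec_entry : Primrec fun x : (List Bool × List Bool) × ℕ => entry x.1.1 x.1.2 x.2 := by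
  have h1 : Primrec fun z : ((List Bool × List Bool) × ℕ) × List Bool × List Bool =>
      z.1.1.1.getD z.1.2 false :=
    (Primrec.list_getD false).comp (Primrec.fst.comp (Primrec.fst.comp Primrec.fst))
      (Primrec.snd.comp Primrec.fst)
  have h2 : Primrec fun z : ((List Bool × List Bool) × ℕ) × List Bool × List Bool =>
      z.1.1.2.take z.2.1.length :=
    Primrec.list_take.comp (Primrec.list_length.comp (Primrec.fst.comp Primrec.snd))
      (Primrec.snd.comp (Primrec.fst.comp Primrec.fst))
  have h3 : Primrec₂ fun (x : (List Bool × List Bool) × ℕ) (y : List Bool × List Bool) =>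
      if x.1.1.getD x.2 false = true ∧ x.1.2.take y.1.length = y.1 then y.2 else [] :=
    (Primrec.ite ((Primrec.eq.comp h1 (Primrec.const true)).and
      (Primrec.eq.comp h2 (Primrec.fst.comp Primrec.snd)))
      (Primrec.snd.comp Primrec.snd) (Primrec.const [])).to₂
  refine (Primrec.option_casesOn (primrec_decodePair.comp Primrec.snd) (Primrec.const [])
    h3).of_eq fun x => ?_
  rw [entry]
  cases decodePair x.2 <;> rfl

theorem computable_run {w u : α → List Bool} (hw : Computable w) (hu : Computable u) :
    Computable fun a => run (w a) (u a) := by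
  have h : Computable₂ fun a j => entry (w a) (u a) j :=
    (primrec_entry.to_comp.comp
      (((hw.comp Computable.fst).pair (hu.comp Computable.fst)).pair Computable.snd)).to₂
  exact primrec_longest.to_comp.comp (computable_map_range h (computable_length hw))

theorem computable_curry {g : α → List Bool → List Bool → List Bool} {w : α → List Bool}
    (hg : Computable fun x : α × List Bool × List Bool => g x.1 x.2.1 x.2.2) (hw : Computable w) :
    Computable fun a => curry (g a) (w a) := by
  refine computable_pre ?_ (computable_length hw)
  have h : Computable₂ fun (x : α × ℕ) (y : List Bool × List Bool) =>
      decide (g x.1 ((w x.1).take y.1.length) y.1 = y.2) :=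
    (Primrec.eq.decide.to_comp.comp
      (hg.comp ((Computable.fst.comp Computable.fst).pair
        ((computable_take (hw.comp (Computable.fst.comp Computable.fst))
          (computable_length (Computable.fst.comp Computable.snd))).pair
          (Computable.fst.comp Computable.snd))))
      (Computable.snd.comp Computable.snd)).to₂
  refine (Computable.option_casesOn (primrec_decodePair.to_comp.comp Computable.snd)
    (Computable.const false) h).of_eq fun x => ?_
  dsimp only [code]
  generalize decodePair x.2 = o
  cases o <;> rfl

theorem computable_evens : Computable evens :=
  computable_pre
    (computable_getD Computable.fst
      (Primrec.nat_mul.to_comp.comp (Computable.const 2) Computable.snd))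
    (Primrec.nat_div.to_comp.comp (Computable.succ.comp Computable.list_length)
      (Computable.const 2))

theorem computable_odds : Computable odds :=
  computable_pre
    (computable_getD Computable.fst
      (Computable.succ.comp (Primrec.nat_mul.to_comp.comp (Computable.const 2) Computable.snd)))
    (Primrec.nat_div.to_comp.comp Computable.list_length (Computable.const 2))

theorem computable_hit : Computable hit := by
  have h : Primrec fun w : List Bool => decide (w.idxOf true < w.length) :=
    Primrec.nat_lt.decide.comp (Primrec.list_idxOf.comp (Primrec.const true) Primrec.id)
      Primrec.list_length
  exact h.to_comp.of_eq fun w => by simp only [hit, List.idxOf_lt_length_iff]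

end Computability

/-! ### Names of functions and of open sets -/

namespace Representation

variable {X Y : Type*} {δX : Representation X} {δY : Representation Y}

theorem FunName.approximates {p q : Cantor} {f : X → Y} {x : X} {a b : ℕ → List Bool}
    (hp : δX.FunName δY p f) (hq : δX.Names q x) (ha : Approximates a p)
    (hb : Approximates b q) :
    ∃ r, Approximates (fun n => run (a n) (b n)) r ∧ δY.Names r (f x) := by
  obtain ⟨h, hc, hr⟩ := hp
  obtain ⟨r, hr, hy⟩ := hr q x hq
  exact ⟨r, hc.approximates hr ha hb, hy⟩

theorem funName_code {g : List Bool → List Bool → List Bool} {p : Cantor} {f : X → Y}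
    (H : ∀ q x, δX.Names q x →
      ∃ r, Approximates (fun n => g (pre p n) (pre q n)) r ∧ δY.Names r (f x)) :
    δX.FunName δY (code fun u => g (pre p u.length) u) f := by
  refine ⟨_, codes_code _, fun q x hq => ?_⟩
  obtain ⟨r, hr, hy⟩ := H q x hq
  exact ⟨r, hr.transforms_diag, hy⟩

/-- A set of points has a name as an open set as soon as membership of a point depends, for each of
its names, on a finite prefix of that name only. -/
theorem exists_openName {U : Set X}
    (H : ∀ z x, δX.Names z x → x ∈ U →
      ∃ n, ∀ z' x', pre z' n = pre z n → δX.Names z' x' → x' ∈ U) :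
    ∃ p, δX.FunName sierpinski p (fun x => x ∈ U) := by
  classical
  let c : Cantor → Cantor := fun z j =>
    decide (∀ z' x', pre z' j = pre z j → δX.Names z' x' → x' ∈ U)
  obtain ⟨p, hp⟩ := Codes.exists fun w => pre (c fun i => w.getD i false) w.length
  refine ⟨p, _, hp, fun z x hz => ⟨c z, Approximates.transforms ?_, ?_⟩⟩
  · have e : ∀ n, pre (c fun i => (pre z n).getD i false) (pre z n).length = pre (c z) n := by
      intro n
      rw [pre_length]
      refine pre_congr fun j hj => ?_
      have e' : pre (fun i => (pre z n).getD i false) j = pre z j :=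
        pre_congr fun i hi => pre_getD z (hi.trans hj)
      simp only [c, e']
    simp only [e]
    exact approximates_pre _
  · refine ⟨fun hx => ?_, ?_⟩
    · obtain ⟨n, hn⟩ := H z x hz hx
      exact ⟨n, decide_eq_true hn⟩
    · rintro ⟨n, hn⟩
      exact of_decide_eq_true hn z x rfl hz

/-- From a name of `x`, a name of `{U | x ∈ U}`, that is, of `{x}` as a compact set: evaluate the
given name of `U` at the name of `x`. -/
theorem funName_singleton {u : Cantor} {x : X} (hu : δX.Names u x) :
    δX.opens.FunName sierpinski (code fun t => run t (pre u t.length))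
      (fun U => {x} ⊆ U.1) := by
  refine funName_code (g := fun u t => run t u) fun q U hq => ?_
  obtain ⟨r, hr, hx⟩ := FunName.approximates hq hu (approximates_pre q) (approximates_pre u)
  exact ⟨r, hr, by simpa only [Set.singleton_subset_iff] using hx⟩

end Representation

theorem closedSet_of_isClosed {A : Set Cantor} (hA : IsClosed A) :
    ∃ p, cantor.FunName sierpinski p (fun x => x ∉ A) := by
  refine Representation.exists_openName (δX := cantor) (U := Aᶜ) fun z x hz hx => ?_
  obtain rfl : z = x := hz
  obtain ⟨I, V, hV, hI⟩ := isOpen_pi_iff.1 hA.isOpen_compl z hx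
  refine ⟨I.sup id + 1, fun z' x' e hz' => ?_⟩
  obtain rfl : z' = x' := hz'
  refine hI fun i hi => ?_
  have h : i ≤ I.sup id := Finset.le_sup (f := id) hi
  rw [eq_of_pre_eq e (Nat.lt_succ_of_le h)]
  exact (hV i hi).2

/-! ### Computable metric spaces -/

/-- The characteristic sequence of the graph of `s`. -/
def graph (s : ℕ → ℕ) : Cantor := fun k => decide (s k.unpair.1 = k.unpair.2)

theorem graph_pair (s : ℕ → ℕ) (n i : ℕ) : graph s (Nat.pair n i) = true ↔ s n = i := by
  simp [graph]

namespace ComputableMetric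

variable {X : Type*} [MetricSpace X] (M : ComputableMetric X) {δ : Representation X}

theorem names_graph {s : ℕ → ℕ} {x : X} (h : ∀ n, dist (M.pt (s n)) x ≤ 1 / 2 ^ n) :
    M.cauchy.Names (graph s) x :=
  ⟨s, graph_pair s, h⟩

theorem exists_index (x : X) (n : ℕ) : ∃ i, dist (M.pt i) x < 1 / 2 ^ n := by
  obtain ⟨i, hi⟩ := M.dense.exists_dist_lt x (show (0 : ℝ) < 1 / 2 ^ n by positivity)
  exact ⟨i, by rwa [dist_comm]⟩

theorem exists_two_pow_lt {ε : ℝ} (hε : 0 < ε) : ∃ k : ℕ, ∀ m ≥ k, 1 / 2 ^ m < ε := by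
  obtain ⟨k, hk⟩ := exists_pow_lt_of_lt_one hε (show (1 / 2 : ℝ) < 1 by norm_num)
  refine ⟨k, fun m hm => ?_⟩
  rw [← one_div_pow]
  exact (pow_le_pow_of_le_one (by norm_num) (by norm_num) hm).trans_lt hk

variable {M}

theorem openSet_of_isOpen (hδ : δ.IsComputable M.cauchy id) {U : Set X} (hU : IsOpen U) :
    ∃ p, δ.FunName sierpinski p (fun x => x ∈ U) := by
  obtain ⟨T, -, hT⟩ := hδ
  refine Representation.exists_openName fun z x hz hx => ?_
  obtain ⟨c, hc, s, hs, hd⟩ := hT z x hz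
  obtain ⟨ε, hε, hb⟩ := Metric.isOpen_iff.1 hU x hx
  obtain ⟨k, hk⟩ := exists_two_pow_lt (half_pos hε)
  obtain ⟨n, hn⟩ := hc.2 (Nat.pair k (s k) + 1)
  refine ⟨n, fun z' x' e hz' => hb ?_⟩
  obtain ⟨c', hc', s', hs', hd'⟩ := hT z' x' hz'
  have e1 := hc'.eq_pre n
  rw [e, hc.eq_pre n, pre_length] at e1
  have e2 : s' k = s k := by
    rw [← hs', ← eq_of_pre_eq e1 hn, hs]
  have h1 := hd k
  have h2 := hd' k
  rw [e2] at h2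
  have h3 := dist_triangle_left x' x (M.pt (s k))
  have h4 := hk k le_rfl
  simp only [id] at h1 h2
  rw [Metric.mem_ball]
  linarith

/-- The topology given by the representation of a metric space is `T₁`, so that singletons are
among its (saturated) compact sets. -/
theorem eq_of_forall_openSet (hδ : δ.IsComputable M.cauchy id) (x y : X)
    (h : ∀ U : δ.OpenSet, {x} ⊆ U.1 → y ∈ U.1) : y = x := by
  by_contra hne
  have hp := openSet_of_isOpen hδ (isOpen_compl_singleton (x := y))
  exact h ⟨{y}ᶜ, hp⟩ (by simpa [eq_comm] using hne) rfl

/-- Sets with an open name are open in the metric: a name of `x` can be chosen so that each of its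
prefixes is also a prefix of some name of every point near `x`. -/
theorem isOpen_of_funName (hδ : M.cauchy.IsComputable δ id) {U : Set X} {p : Cantor}
    (hp : δ.FunName sierpinski p (fun x => x ∈ U)) : IsOpen U := by
  obtain ⟨T, -, hT⟩ := hδ
  have key : ∀ {c x}, M.cauchy.Names c x → ∃ r,
      Approximates (fun n => run (pre p n) (mono T (pre c n))) r ∧
        (x ∈ U ↔ ∃ i, r i = true) := fun {c x} hc => by
    obtain ⟨z, hz, hx⟩ := hT c x hc
    exact hp.approximates hx (approximates_pre p) (hz.approximates (approximates_pre c))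
  refine Metric.isOpen_iff.2 fun x hx => ?_
  -- a name that converges twice as fast as necessary leaves room for the points near `x`
  choose s hs using fun n => M.exists_index x (n + 1)
  obtain ⟨r, hr, hxr⟩ := key (M.names_graph (s := s) fun n => (hs n).le.trans (by
    gcongr <;> norm_num))
  obtain ⟨N, hN⟩ := (hr.eventually_hit (hxr.1 hx)).exists
  refine ⟨1 / 2 ^ (N + 1), by positivity, fun y hy => ?_⟩
  rw [Metric.mem_ball, dist_comm] at hy
  choose t ht using M.exists_index y
  let s' : ℕ → ℕ := fun n => if n < N then s n else t n
  have hs' : ∀ n, dist (M.pt (s' n)) y ≤ 1 / 2 ^ n := fun n => by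
    by_cases hn : n < N
    · have h1 := dist_triangle (M.pt (s n)) x y
      have h2 := hs n
      have h3 : (1 : ℝ) / 2 ^ (N + 1) ≤ 1 / 2 ^ (n + 1) := by gcongr; norm_num
      have h4 : (1 : ℝ) / 2 ^ n = 1 / 2 ^ (n + 1) + 1 / 2 ^ (n + 1) := by
        rw [pow_succ]; field_simp; norm_num
      simp only [s', if_pos hn]
      linarith
    · simpa only [s', if_neg hn] using (ht n).le
  have e : pre (graph s') N = pre (graph s) N := pre_congr fun i hi => by
    have : i.unpair.1 < N := (Nat.unpair_left_le i).trans_lt hi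
    simp only [graph, s', if_pos this]
  obtain ⟨r', hr', hyr⟩ := key (M.names_graph hs')
  refine hyr.2 (hr'.exists_of_hit (n := N) ?_)
  rw [e]
  exact hN

end ComputableMetric

/-! ### Inclusion of a fibre in an open set -/

/-- The test for `δ⁻¹[{x}] ⊆ W`, on prefixes `u` of a name of `x` and `o` of a name of `W`; here
`P` realizes `K ↦ δ⁻¹[K]`. The word `curry (fun u t => run t u) u` is a prefix of a name of the
compact set `{x}`. -/
def fiberTest (P : List Bool → List Bool) (u o : List Bool) : List Bool :=
  run (mono P (curry (fun u t => run t u) u)) o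

theorem approximates_fiberTest {X : Type*} {δ : Representation X} {P : List Bool → List Bool}
    {F : δ.CompactSet → cantor.CompactSet} (hF : ∀ K, (F K).1 = δ.preimage K.1)
    (hP : δ.compacts.Realizes cantor.compacts P F)
    (hδ : ∀ x y : X, (∀ U : δ.OpenSet, {x} ⊆ U.1 → y ∈ U.1) → y = x)
    {u o : Cantor} {x : X} {W : Set Cantor} (hu : δ.Names u x)
    (ho : cantor.FunName sierpinski o (fun z => z ∈ W)) {b : ℕ → List Bool}
    (hb : Approximates b o) :
    ∃ r, Approximates (fun n => fiberTest P (pre u n) (b n)) r ∧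
      ((∀ z, δ.Names z x → z ∈ W) ↔ ∃ i, r i = true) := by
  have hx := Representation.funName_singleton hu
  let K : δ.CompactSet := ⟨{x}, fun y hy => hδ x y hy, _, hx⟩
  obtain ⟨c, hc, hK⟩ := hP _ K hx
  obtain ⟨r, hr, hr'⟩ := Representation.FunName.approximates (δX := cantor.opens)
    (x := ⟨W, o, ho⟩) hK ho
    (hc.approximates ((approximates_pre u).curry fun u t => run t u)) hb
  have e : (∀ z, δ.Names z x → z ∈ W) ↔ (F K).1 ⊆ W := by
    rw [hF]
    simp [K, Representation.preimage, Set.subset_def]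
  exact ⟨r, hr, e.trans hr'⟩

/-! ### Balls in the range space -/

/-- Whether an index `k` at place `m` of a Cauchy name of `y`, where `j = ⟨m, k⟩`, and the
approximation `c (k, i, m)` of the distance of the points `k` and `i` show that `y` has distance
less than `2⁻ⁿ` from the point `i`. -/
def near (c : ℕ × ℕ × ℕ → ℕ) (n i j : ℕ) : Bool :=
  decide ((c (j.unpair.2, i, j.unpair.1) + 2) * 2 ^ n < 2 ^ j.unpair.1)

/-- Whether the prefix `w` of a Cauchy name of `y` shows that `y` has distance less than `2⁻ⁿ`
from the point `i`. -/
def seenNear (c : ℕ × ℕ × ℕ → ℕ) (n i : ℕ) (w : List Bool) : Bool :=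
  hit (pre (fun j => w.getD j false && near c n i j) w.length)

section Metric

variable {Y : Type*} [MetricSpace Y] {M : ComputableMetric Y} {c : ℕ × ℕ × ℕ → ℕ}
  {p : Cantor} {y : Y} {a : ℕ → List Bool} {n i : ℕ}

theorem Approximates.seenNear_iff (ha : Approximates a p) (k : ℕ) : seenNear c n i (a k) = true ↔
    ∃ j < (a k).length, p j = true ∧ near c n i j = true := by
  rw [seenNear, hit, decide_eq_true_eq, pre_pos]
  refine exists_congr fun j => and_congr_right fun hj => ?_
  rw [Bool.and_eq_true]
  have := pre_getD p hj
  rw [← ha.1 k] at this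
  rw [this]

theorem Approximates.dist_lt_of_seenNear (ha : Approximates a p)
    (hc : ∀ i j n, |dist (M.pt i) (M.pt j) - (c (i, j, n) : ℝ) / 2 ^ n| ≤ 1 / 2 ^ n)
    (hp : M.cauchy.Names p y) {k : ℕ}
    (h : seenNear c n i (a k) = true) :
    dist y (M.pt i) < 1 / 2 ^ n := by
  obtain ⟨j, -, hj, hn⟩ := (ha.seenNear_iff k).1 h
  obtain ⟨s, hs, hd⟩ := hp
  have e := (hs j.unpair.1 j.unpair.2).1 (by rwa [Nat.pair_unpair])
  rw [near, decide_eq_true_eq] at hn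
  generalize j.unpair.1 = m at *
  generalize j.unpair.2 = l at *
  subst e
  have h1 := hd m
  have h2 := (abs_le.1 (hc (s m) i m)).2
  have h3 := dist_triangle_left y (M.pt i) (M.pt (s m))
  have h4 : ((c (s m, i, m) : ℝ) + 2) * 2 ^ n < 2 ^ m := by exact_mod_cast hn
  have h5 : ((c (s m, i, m) : ℝ) + 2) / 2 ^ m < 1 / 2 ^ n := by
    rw [div_lt_div_iff₀ (by positivity) (by positivity), one_mul]
    exact h4
  rw [add_div] at h5
  have h6 : (2 : ℝ) / 2 ^ m = 1 / 2 ^ m + 1 / 2 ^ m := by ring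
  linarith

theorem Approximates.eventually_seenNear (ha : Approximates a p)
    (hc : ∀ i j n, |dist (M.pt i) (M.pt j) - (c (i, j, n) : ℝ) / 2 ^ n| ≤ 1 / 2 ^ n)
    (hp : M.cauchy.Names p y)
    (h : dist y (M.pt i) < 1 / 2 ^ n) :
    ∀ᶠ k in atTop, seenNear c n i (a k) = true := by
  obtain ⟨s, hs, hd⟩ := id hp
  obtain ⟨m, hm⟩ := ComputableMetric.exists_two_pow_lt
    (show 0 < (1 / 2 ^ n - dist y (M.pt i)) / 4 by linarith)
  -- two errors `2⁻ᵐ` come from the name and two from rounding the distance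
  have hm := hm m le_rfl
  filter_upwards [ha.2.eventually_gt_atTop (Nat.pair m (s m))] with k hk
  refine (ha.seenNear_iff k).2 ⟨_, hk, (hs _ _).2 rfl, ?_⟩
  rw [near, decide_eq_true_eq, Nat.unpair_pair]
  have h1 := hd m
  have h2 := (abs_le.1 (hc (s m) i m)).1
  have h3 := dist_triangle (M.pt (s m)) y (M.pt i)
  have h5 : ((c (s m, i, m) : ℝ) + 2) / 2 ^ m < 1 / 2 ^ n := by
    rw [add_div]
    have h6 : (2 : ℝ) / 2 ^ m = 1 / 2 ^ m + 1 / 2 ^ m := by ring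
    linarith
  rw [div_lt_div_iff₀ (by positivity) (by positivity), one_mul] at h5
  exact_mod_cast h5

end Metric

/-- Whether, for `w` a prefix of the pair of a name of `A` and a name of `f`, it has been seen
that the point with prefix `z` lies outside `A`, or is mapped by `f` to a point at distance less
than `2⁻ⁿ` from the point `i`; here `T` translates names into Cauchy names. -/
def seenBall (c : ℕ × ℕ × ℕ → ℕ) (T : List Bool → List Bool) (n i : ℕ) (w z : List Bool) : Bool :=
  hit (run (evens w) z) || seenNear c n i (mono T (run (odds w) z))

/-- The history of `seenBall`, as a prefix of a name of a point of Sierpiński space. -/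
def ball (c : ℕ × ℕ × ℕ → ℕ) (T : List Bool → List Bool) (n i : ℕ) (w z : List Bool) :
    List Bool :=
  pre (fun j => seenBall c T n i (w.take j) (z.take j)) z.length

theorem ball_pre (c : ℕ × ℕ × ℕ → ℕ) (T : List Bool → List Bool) (n i : ℕ) (p z : Cantor)
    (m : ℕ) : ball c T n i (pre p m) (pre z m) =
      pre (fun j => seenBall c T n i (pre p j) (pre z j)) m := by
  rw [ball, pre_length]
  refine pre_congr fun j hj => ?_
  rw [pre_take, pre_take, min_eq_left hj.le]

theorem funName_ball (c : ℕ × ℕ × ℕ → ℕ) (T : List Bool → List Bool) (n i : ℕ) (p : Cantor) :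
    cantor.FunName sierpinski (code fun z => ball c T n i (pre p z.length) z)
      (fun z => z ∈ {z | ∃ j, seenBall c T n i (pre p j) (pre z j) = true}) := by
  refine Representation.funName_code fun q z hq => ⟨_, ?_, Iff.rfl⟩
  obtain rfl : q = z := hq
  simp only [ball_pre]
  exact approximates_pre _

/-! ### Unbounded search -/

/-- The first `m < N` with `B n m`, or `N` if there is none. -/
def firstHit (B : ℕ → ℕ → Bool) (n N : ℕ) : ℕ := (pre (B n) N).idxOf true

/-- The prefix that can be found from the bits `B n m` with `m < N` of the graph of the sequence
whose `n`-th entry is the first component of the least `m` with `B n m`. -/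
def choices (B : ℕ → ℕ → Bool) (N : ℕ) : List Bool :=
  pre (graph fun n => (firstHit B n N).unpair.1)
    ((pre (fun j => decide (firstHit B j.unpair.1 N < N)) N).idxOf false)

theorem choices_congr {B B' : ℕ → ℕ → Bool} {N : ℕ} (h : ∀ n, ∀ m < N, B n m = B' n m) :
    choices B N = choices B' N := by
  have e : ∀ n, firstHit B n N = firstHit B' n N := fun n => by
    rw [firstHit, firstHit, pre_congr (h n)]
  simp only [choices, e]

theorem le_idxOf_pre {f : Cantor} {b : Bool} {N m : ℕ} (hm : m ≤ N) :
    m ≤ (pre f N).idxOf b ↔ ∀ k < m, f k ≠ b := by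
  induction N generalizing f m with
  | zero => simp [show m = 0 by omega]
  | succ N ih =>
    have e : pre f (N + 1) = f 0 :: pre (fun k => f (k + 1)) N := by
      simp [pre, List.range_succ_eq_map, Function.comp_def]
    rw [e, List.idxOf_cons]
    rcases m with _ | m
    · simp
    · by_cases h0 : f 0 = b
      · simp only [h0, beq_self_eq_true, cond_true]
        exact iff_of_false (by omega) fun h => h 0 (by omega) h0
      · rw [beq_false_of_ne h0, cond_false, Nat.succ_le_succ_iff, ih (by omega)]
        exact ⟨fun h k hk => by rcases k with _ | k; exacts [h0, h k (by omega)],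
          fun h k hk => h (k + 1) (by omega)⟩

theorem approximates_choices {B : ℕ → ℕ → Bool} (h : ∀ n, ∃ m, B n m = true) :
    ∃ m : ℕ → ℕ, (∀ n, B n (m n) = true) ∧
      Approximates (choices B) (graph fun n => (m n).unpair.1) := by
  have eq_find : ∀ {n N}, Nat.find (h n) < N → firstHit B n N = Nat.find (h n) := fun {n N} hN => by
    refine le_antisymm (not_lt.1 fun hlt => ?_) ?_
    · exact (le_idxOf_pre (m := Nat.find (h n) + 1) hN).1 hlt _ (Nat.lt_succ_self _)
        (Nat.find_spec (h n))
    · exact (le_idxOf_pre hN.le).2 fun k hk => Nat.find_min (h n) hk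
  have lt : ∀ {n N}, firstHit B n N < N ↔ Nat.find (h n) < N := fun {n N} =>
    ⟨fun hN => not_le.1 fun hle => absurd hN (not_lt.2 ((le_idxOf_pre le_rfl).2 fun k hk =>
      Nat.find_min (h n) (hk.trans_le hle))), fun hN => by rwa [eq_find hN]⟩
  have len : ∀ N, (choices B N).length ≤ N := fun N => by
    rw [choices, pre_length]
    exact List.idxOf_le_length.trans (pre_length _ _).le
  refine ⟨fun n => Nat.find (h n), fun n => Nat.find_spec (h n), fun N => ?_,
    tendsto_atTop.2 fun L => ?_⟩
  · have e := (le_idxOf_pre (f := fun j => decide (firstHit B j.unpair.1 N < N)) (b := false)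
      (len N)).1 (by rw [choices, pre_length])
    conv_lhs => rw [choices]
    rw [choices, pre_length] at e ⊢
    refine pre_congr fun j hj => ?_
    -- up to the chosen length, all searches have ended before stage `N`
    have e1 : firstHit B j.unpair.1 N < N := by simpa using e j hj
    simp only [graph, eq_find (lt.1 e1)]
  · filter_upwards [eventually_ge_atTop L, eventually_all_finset (Finset.range L) |>.2
      fun j _ => eventually_gt_atTop (Nat.find (h j.unpair.1))] with N hL hN
    rw [choices, pre_length, le_idxOf_pre hL]
    intro j hj
    simpa using lt.2 (hN j (Finset.mem_range.2 hj))

/-! ### Computability of tests and searches -/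

section Computability

variable {α : Type*} [Primcodable α]

theorem primrec_two_pow : Primrec fun n : ℕ => 2 ^ n := by
  refine (Primrec.nat_rec₁ 1 ((Primrec.nat_mul.comp Primrec.snd (Primrec.const 2)).to₂)).of_eq
    fun n => ?_
  induction n with
  | zero => rfl
  | succ n ih => rw [pow_succ, ← ih]

theorem computable_fiberTest {P : List Bool → List Bool} (hP : Computable P)
    {u o : α → List Bool} (hu : Computable u) (ho : Computable o) :
    Computable fun a => fiberTest P (u a) (o a) :=
  computable_run ((computable_mono hP).comp (computable_curry
    (computable_run (Computable.snd.comp Computable.snd) (Computable.fst.comp Computable.snd)) hu))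
    ho

theorem computable_near {c : ℕ × ℕ × ℕ → ℕ} (hc : Computable c) {n i j : α → ℕ}
    (hn : Computable n) (hi : Computable i) (hj : Computable j) :
    Computable fun a => near c (n a) (i a) (j a) := by
  have h1 : Computable fun a => (j a).unpair.1 := Computable.fst.comp (Computable.unpair.comp hj)
  have h2 : Computable fun a => (j a).unpair.2 := Computable.snd.comp (Computable.unpair.comp hj)
  have h3 : Computable fun a => c ((j a).unpair.2, i a, (j a).unpair.1) :=
    hc.comp (h2.pair (hi.pair h1))
  exact Primrec.nat_lt.decide.to_comp.comp
    (Primrec.nat_mul.to_comp.comp (Primrec.nat_add.to_comp.comp h3 (Computable.const 2))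
      (primrec_two_pow.to_comp.comp hn)) (primrec_two_pow.to_comp.comp h1)

theorem computable_seenNear {c : ℕ × ℕ × ℕ → ℕ} (hc : Computable c) {n i : α → ℕ}
    {w : α → List Bool} (hn : Computable n) (hi : Computable i) (hw : Computable w) :
    Computable fun a => seenNear c (n a) (i a) (w a) := by
  have h : Computable₂ fun a j => (w a).getD j false && near c (n a) (i a) j :=
    (Primrec.and.to_comp.comp (computable_getD (hw.comp Computable.fst) Computable.snd)
      (computable_near hc (hn.comp Computable.fst) (hi.comp Computable.fst) Computable.snd)).to₂
  exact computable_hit.comp (computable_pre h (computable_length hw))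

theorem computable_ball {c : ℕ × ℕ × ℕ → ℕ} (hc : Computable c) {T : List Bool → List Bool}
    (hT : Computable T) {n i : α → ℕ} {w z : α → List Bool} (hn : Computable n)
    (hi : Computable i) (hw : Computable w) (hz : Computable z) :
    Computable fun a => ball c T (n a) (i a) (w a) (z a) := by
  have hw' : Computable fun x : α × ℕ => (w x.1).take x.2 :=
    computable_take (hw.comp Computable.fst) Computable.snd
  have hz' : Computable fun x : α × ℕ => (z x.1).take x.2 :=
    computable_take (hz.comp Computable.fst) Computable.snd
  have h : Computable₂ fun a j => seenBall c T (n a) (i a) ((w a).take j) ((z a).take j) :=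
    (Primrec.or.to_comp.comp
      (computable_hit.comp (computable_run (computable_evens.comp hw') hz'))
      (computable_seenNear hc (hn.comp Computable.fst) (hi.comp Computable.fst)
        ((computable_mono hT).comp (computable_run (computable_odds.comp hw') hz')))).to₂
  exact computable_pre h (computable_length hz)

theorem computable_firstHit {B : α → ℕ → ℕ → Bool} {n N : α → ℕ}
    (hB : Computable fun x : α × ℕ × ℕ => B x.1 x.2.1 x.2.2) (hn : Computable n)
    (hN : Computable N) : Computable fun a => firstHit (B a) (n a) (N a) := by
  have h : Computable₂ fun a m => B a (n a) m :=
    (hB.comp (Computable.fst.pair ((hn.comp Computable.fst).pair Computable.snd))).to₂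
  exact Primrec.list_idxOf.to_comp.comp (Computable.const true) (computable_pre h hN)

theorem computable_choices {B : α → ℕ → ℕ → Bool} {N : α → ℕ}
    (hB : Computable fun x : α × ℕ × ℕ => B x.1 x.2.1 x.2.2) (hN : Computable N) :
    Computable fun a => choices (B a) (N a) := by
  have h1 : Computable fun x : α × ℕ => firstHit (B x.1) x.2.unpair.1 (N x.1) :=
    computable_firstHit
      (hB.comp ((Computable.fst.comp Computable.fst).pair Computable.snd))
      (Computable.fst.comp (Computable.unpair.comp Computable.snd)) (hN.comp Computable.fst)
  have h2 : Computable₂ fun (a : α) (j : ℕ) => decide (firstHit (B a) j.unpair.1 (N a) < N a) :=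
    (Primrec.nat_lt.decide.to_comp.comp h1 (hN.comp Computable.fst)).to₂
  have h3 : Computable₂ fun a => graph fun n => (firstHit (B a) n (N a)).unpair.1 :=
    (Primrec.eq.decide.to_comp.comp (Computable.fst.comp (Computable.unpair.comp h1))
      (Computable.snd.comp (Computable.unpair.comp Computable.snd))).to₂
  exact computable_pre h3
    (Primrec.list_idxOf.to_comp.comp (Computable.const false) (computable_pre h2 hN))

end Computability

/-! ### Images of closed sets, and extension of functions to all names -/

/-- From a name of a closed set `A` of sequences, a name of `δ[A]` as a closed set. -/
theorem funName_compl_image {X : Type*} {δ : Representation X} {P : List Bool → List Bool}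
    {F : δ.CompactSet → cantor.CompactSet} (hF : ∀ K, (F K).1 = δ.preimage K.1)
    (hP : δ.compacts.Realizes cantor.compacts P F)
    (hδ : ∀ x y : X, (∀ U : δ.OpenSet, {x} ⊆ U.1 → y ∈ U.1) → y = x)
    {p : Cantor} {A : Set Cantor} (hp : cantor.FunName sierpinski p (fun z => z ∉ A)) :
    δ.FunName sierpinski (code fun u => fiberTest P u (pre p u.length))
      (fun x => x ∉ δ.image A) := by
  refine Representation.funName_code (g := fun w u => fiberTest P u w) fun u x hu => ?_
  obtain ⟨r, hr, hx⟩ := approximates_fiberTest (W := Aᶜ) hF hP hδ hu hp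
    (approximates_pre p)
  refine ⟨r, hr, Iff.trans ?_ hx⟩
  simp only [Representation.image, Set.mem_ofPred_eq, Set.mem_compl_iff, not_exists, not_and]
  exact forall_congr' fun z => ⟨fun h h1 h2 => h h2 h1, fun h h1 h2 => h h2 h1⟩

/-- The prefix of a Cauchy name of `f x` that can be found from prefixes `w` of the pair of a name
of `A` and a name of `f` and `u` of a name of `x`. For every `n`, this searches for a point `i` and
a stage `m` such that every name of `x` is, by stage `m`, known to lie outside `A` or to be mapped
by `f` to a point at distance less than `2⁻ⁿ` from the point `i`. -/
def cauchyValue (c : ℕ × ℕ × ℕ → ℕ) (P T : List Bool → List Bool) (w u : List Bool) :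
    List Bool :=
  choices (fun n m => hit (fiberTest P (u.take m) (curry (ball c T n m.unpair.1) (w.take m))))
    u.length

section Extension

variable {X Y : Type*} [MetricSpace Y] {M : ComputableMetric Y} {c : ℕ × ℕ × ℕ → ℕ}
  {δX : Representation X} {δY : Representation Y} {P T : List Bool → List Bool}
  {F : δX.CompactSet → cantor.CompactSet} {A : Set Cantor} {f : δX.image A → Y}
  {p q : Cantor}

/-- For `x ∈ δ[A]`, the distance of `f x` to a point is bounded by what is seen on all names of `x`:
those in `A`, of which there is at least one, give correct values, and all others are seen to lie
outside `A`. -/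
theorem forall_seenBall_iff
    (hc : ∀ i j n, |dist (M.pt i) (M.pt j) - (c (i, j, n) : ℝ) / 2 ^ n| ≤ 1 / 2 ^ n)
    (hT : δY.Realizes M.cauchy T id) (hp : cantor.FunName sierpinski p (fun z => z ∉ A))
    (hq : (δX.restrict A).FunName δY q f) (x : δX.image A) (n i : ℕ) :
    (∀ z, δX.Names z x.1 →
        ∃ j, seenBall c T n i (pre (interleave p q) j) (pre z j) = true) ↔
      dist (f x) (M.pt i) < 1 / 2 ^ n := by
  have inA : ∀ z, ∃ r,
      Approximates (fun j => run (evens (pre (interleave p q) j)) (pre z j)) r ∧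
        (z ∉ A ↔ ∃ i, r i = true) := fun z =>
    hp.approximates (x := z) rfl (approximates_evens p q) (approximates_pre z)
  have val : ∀ z ∈ A, δX.Names z x.1 → ∃ r,
      Approximates (fun j => mono T (run (odds (pre (interleave p q) j)) (pre z j))) r ∧
        M.cauchy.Names r (f x) := fun z hz hzx => by
    obtain ⟨r, hr, hy⟩ := hq.approximates (x := x) ⟨hz, hzx⟩ (approximates_odds p q)
      (approximates_pre z)
    obtain ⟨r', hr', hy'⟩ := hT r _ hy
    exact ⟨r', hr'.approximates hr, hy'⟩
  constructor
  · intro h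
    obtain ⟨z, hz, hzx⟩ := x.2
    obtain ⟨j, hj⟩ := h z hzx
    obtain ⟨r, hr, hr'⟩ := inA z
    obtain ⟨s, hs, hs'⟩ := val z hz hzx
    rcases Bool.or_eq_true _ _ |>.mp hj with hj | hj
    · exact absurd hz (hr'.2 (hr.exists_of_hit hj))
    · exact hs.dist_lt_of_seenNear hc hs' hj
  · intro h z hzx
    by_cases hz : z ∈ A
    · obtain ⟨s, hs, hs'⟩ := val z hz hzx
      obtain ⟨j, hj⟩ := (hs.eventually_seenNear hc hs' h).exists
      exact ⟨j, Bool.or_eq_true _ _ |>.mpr (Or.inr hj)⟩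
    · obtain ⟨r, hr, hr'⟩ := inA z
      obtain ⟨j, hj⟩ := (hr.eventually_hit (hr'.1 hz)).exists
      exact ⟨j, Bool.or_eq_true _ _ |>.mpr (Or.inl hj)⟩

theorem approximates_cauchyValue (hF : ∀ K, (F K).1 = δX.preimage K.1)
    (hP : δX.compacts.Realizes cantor.compacts P F)
    (hδ : ∀ x y : X, (∀ U : δX.OpenSet, {x} ⊆ U.1 → y ∈ U.1) → y = x)
    (hc : ∀ i j n, |dist (M.pt i) (M.pt j) - (c (i, j, n) : ℝ) / 2 ^ n| ≤ 1 / 2 ^ n)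
    (hT : δY.Realizes M.cauchy T id) (hp : cantor.FunName sierpinski p (fun z => z ∉ A))
    (hq : (δX.restrict A).FunName δY q f) {u : Cantor} {x : δX.image A}
    (hu : δX.Names u x.1) :
    ∃ r, Approximates (fun n => cauchyValue c P T (pre (interleave p q) n) (pre u n)) r ∧
      M.cauchy.Names r (f x) := by
  set pq := interleave p q
  let B : ℕ → ℕ → Bool := fun n m =>
    hit (fiberTest P (pre u m) (curry (ball c T n m.unpair.1) (pre pq m)))
  have test : ∀ n i, ∃ r,
      Approximates (fun m => fiberTest P (pre u m) (curry (ball c T n i) (pre pq m))) r ∧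
        (dist (f x) (M.pt i) < 1 / 2 ^ n ↔ ∃ k, r k = true) := fun n i => by
    obtain ⟨r, hr, hr'⟩ := approximates_fiberTest hF hP hδ hu (funName_ball c T n i pq)
      ((approximates_pre pq).curry (ball c T n i))
    exact ⟨r, hr, (forall_seenBall_iff hc hT hp hq x n i).symm.trans hr'⟩
  have ex : ∀ n, ∃ m, B n m = true := fun n => by
    obtain ⟨i, hi⟩ := M.exists_index (f x) n
    rw [dist_comm] at hi
    obtain ⟨r, hr, hr'⟩ := test n i
    obtain ⟨N, hN⟩ := eventually_atTop.1 (hr.eventually_hit (hr'.1 hi))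
    -- the point `i` is tried at arbitrarily late stages
    refine ⟨Nat.pair i N, ?_⟩
    simp only [B, Nat.unpair_pair]
    exact hN _ (Nat.right_le_pair i N)
  obtain ⟨m, hm, happ⟩ := approximates_choices ex
  refine ⟨graph fun n => (m n).unpair.1, ?_, M.names_graph fun n => ?_⟩
  · have e : ∀ n, cauchyValue c P T (pre pq n) (pre u n) = choices B n := fun n => by
      rw [cauchyValue, pre_length]
      refine choices_congr fun k m hm => ?_
      rw [pre_take, pre_take, min_eq_left hm.le]
    simpa only [e] using happ
  · obtain ⟨r, hr, hr'⟩ := test n (m n).unpair.1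
    rw [dist_comm]
    exact (hr'.2 (hr.exists_of_hit (hm n))).le

theorem computable_cauchyValue (hc : Computable c) (hP : Computable P) (hT : Computable T)
    {α : Type*} [Primcodable α] {w u : α → List Bool} (hw : Computable w) (hu : Computable u) :
    Computable fun a => cauchyValue c P T (w a) (u a) := by
  have hm : Computable fun x : α × ℕ × ℕ => x.2.2 := Computable.snd.comp Computable.snd
  have hb : Computable fun x : (α × ℕ × ℕ) × List Bool × List Bool =>
      ball c T x.1.2.1 x.1.2.2.unpair.1 x.2.1 x.2.2 :=
    computable_ball hc hT (Computable.fst.comp (Computable.snd.comp Computable.fst))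
      (Computable.fst.comp (Computable.unpair.comp (hm.comp Computable.fst)))
      (Computable.fst.comp Computable.snd) (Computable.snd.comp Computable.snd)
  refine computable_choices ?_ (computable_length hu)
  exact computable_hit.comp (computable_fiberTest hP
    (computable_take (hu.comp Computable.fst) hm)
    (computable_curry (g := fun x : α × ℕ × ℕ => ball c T x.2.1 x.2.2.unpair.1) hb
      (computable_take (hw.comp Computable.fst) hm)))

end Extension

end TypeTwo

theorem lemma8 {X Y : Type*} [MetricSpace X] [MetricSpace Y]
    (MX : TypeTwo.ComputableMetric X) (MY : TypeTwo.ComputableMetric Y)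
    (δX : TypeTwo.Representation X) (hδX : δX.Equivalent MX.cauchy)
    (δY : TypeTwo.Representation Y) (hδY : δY.Equivalent MY.cauchy)
    (hproper : δX.IsProper) :
    ((∀ A : Set TypeTwo.Cantor, IsClosed A → IsClosed (δX.image A)) ∧
      ∃ F : TypeTwo.cantor.ClosedSet → δX.ClosedSet,
        (∀ A, (F A).1 = δX.image A.1) ∧
          TypeTwo.cantor.closeds.IsComputable δX.closeds F) ∧
    (∃ h : List Bool → List Bool, Computable h ∧
      ∀ (A : TypeTwo.cantor.ClosedSet) (f : (δX.restrict A.1).ContFun δY) (p q : TypeTwo.Cantor),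
        TypeTwo.cantor.closeds.Names p A → ((δX.restrict A.1).functions δY).Names q f →
          ∃ r, TypeTwo.Transforms h (TypeTwo.interleave p q) r ∧
            (δX.subspace (δX.image A.1)).FunName δY r f.1) := by
  obtain ⟨F, hF, P, hPc, hP⟩ := hproper
  obtain ⟨⟨T, hTc, hT⟩, T', hTc', hT'⟩ := hδY
  obtain ⟨c, hcc, hc⟩ := MY.dist_computable
  have hδ := TypeTwo.ComputableMetric.eq_of_forall_openSet hδX.1
  refine ⟨⟨fun A hA => ?_, ?_⟩, ?_⟩
  · obtain ⟨p, hp⟩ := TypeTwo.closedSet_of_isClosed hA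
    exact isOpen_compl_iff.1
      (TypeTwo.ComputableMetric.isOpen_of_funName hδX.2 (U := (δX.image A)ᶜ)
        (TypeTwo.funName_compl_image hF hP hδ hp))
  · refine ⟨fun A => ⟨δX.image A.1, ?_⟩, fun A => rfl,
      TypeTwo.curry fun w u => TypeTwo.fiberTest P u w, ?_, fun p A hp => ?_⟩
    · obtain ⟨p, hp⟩ := A.2
      exact ⟨_, TypeTwo.funName_compl_image hF hP hδ hp⟩
    · exact TypeTwo.computable_curry (TypeTwo.computable_fiberTest hPc
        (Computable.snd.comp Computable.snd) (Computable.fst.comp Computable.snd)) Computable.id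
    · exact ⟨_, ((TypeTwo.approximates_pre p).curry _).transforms,
        TypeTwo.funName_compl_image hF hP hδ hp⟩
  · refine ⟨TypeTwo.curry fun w u => TypeTwo.mono T' (TypeTwo.cauchyValue c P T w u), ?_,
      fun A f p q hp hq => ⟨_, ((TypeTwo.approximates_pre _).curry _).transforms, ?_⟩⟩
    · exact TypeTwo.computable_curry ((TypeTwo.computable_mono hTc').comp
        (TypeTwo.computable_cauchyValue hcc hPc hTc (Computable.fst.comp Computable.snd)
          (Computable.snd.comp Computable.snd))) Computable.id
    · refine TypeTwo.Representation.funName_code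
        (g := fun w u => TypeTwo.mono T' (TypeTwo.cauchyValue c P T w u)) fun u x hu => ?_
      obtain ⟨s, hs, hs'⟩ := TypeTwo.approximates_cauchyValue hF hP hδ hc hT hp hq hu
      obtain ⟨r, hr, hr'⟩ := hT' s _ hs'
      exact ⟨r, hr.approximates hs, hr'⟩
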